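/- Let $\Theta=(\theta_j^i)_{1\le i,j\le 2}$ be a real matrix such that the five numbers $1,\theta_1^1,\theta_1^2,\theta_2^1,\theta_2^2$ are linearly independent over $\mathbb{Z}$. For $\mathbf{x}=(x_1,x_2)\in\mathbb{Z}^2$ put $L_j(\mathbf{x})=\theta_j^1x_1+\theta_j^2x_2$ $(j=1,2)$ and $M(\mathbf{x})=\max(|x_1|,|x_2|)$; let $\|\cdot\|$ be the distance to the nearest integer and, for $t\ge 1$, $$\psi_\Theta(t)=\min_{\mathbf{x}\in\mathbb{Z}^2,\ 0<M(\mathbf{x})\le t}\ \max_{j=1,2}\|L_j(\mathbf{x})\|.$$ Define the uniform and the individual Diophantine exponents in $(0,+\infty]$ by $$\alpha(\Theta)=\sup\{\gamma>0:\ \limsup_{t\to+\infty}t^\gamma\psi_\Theta(t)<+\infty\},\qquad \beta(\Theta)=\sup\{\gamma>0:\ \liminf_{t\to+\infty}t^\gamma\psi_\Theta(t)<+\infty\}.$$ For real $\alpha\ge 1$ let $$g_3(\alpha)=\frac{1-\alpha+\sqrt{(1-\alpha)^2+4\alpha(2\alpha^2-2\alpha+1)}}{2\alpha},$$ which is the unique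 positive root of $\alpha x^2+(\alpha-1)x-(2\alpha^2-2\alpha+1)=0$. Then $\psi_\Theta(t)>0$ for all $t\ge 1$, $\alpha(\Theta)\ge 1$, and $$\beta(\Theta)\ \ge\ \alpha(\Theta)\,g_3(\alpha(\Theta)),$$ where for $\alpha(\Theta)=+\infty$ this means $\beta(\Theta)=+\infty$. Moreover, for every real $\alpha$ with $1<\alpha<\left(\frac{1+\sqrt5}{2}\right)^2$ one has $\alpha\,g_3(\alpha)>\alpha(\alpha-1)$, so that on this interval the bound is stronger than Jarník's bound $\beta(\Theta)\ge\alpha(\Theta)(\alpha(\Theta)-1)$. -/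

import Mathlib

open scoped ENNReal

noncomputable section

namespace DiophantineExponents

/-- The distance from a real number to the nearest integer. -/
def distInt (y : ℝ) : ℝ := |y - (round y : ℝ)|

/-- `zeta Θ x = max_j ‖L_j(x)‖`, where `L_j(x) = ∑ i, Θ j i * x i` and `‖·‖` is the distance to the
nearest integer (the norm on `Fin n → ℝ` is the maximum norm). -/
def zeta {m n : ℕ} (Θ : Matrix (Fin n) (Fin m) ℝ) (x : Fin m → ℤ) : ℝ :=
  ‖fun j : Fin n => distInt (∑ i : Fin m, Θ j i * (x i : ℝ))‖

/-- `psi Θ t` is the minimum of `zeta Θ x` over the integer vectors `x` with `0 < M(x) ≤ t`, where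
`M(x) = max_i |x i|` is the maximum norm. For `1 ≤ t` and `0 < m` the set of such vectors is finite
and nonempty, so the infimum is a minimum. -/
def psi {m n : ℕ} (Θ : Matrix (Fin n) (Fin m) ℝ) (t : ℝ) : ℝ :=
  sInf (zeta Θ '' {x : Fin m → ℤ | 0 < ‖x‖ ∧ ‖x‖ ≤ t})

/-- The uniform Diophantine exponent `α(Θ)`, an element of `[0, +∞]`. -/
def uniformExponent {m n : ℕ} (Θ : Matrix (Fin n) (Fin m) ℝ) : ℝ≥0∞ :=
  sSup (ENNReal.ofReal '' {γ : ℝ | 0 < γ ∧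
    Filter.limsup (fun t : ℝ => ENNReal.ofReal (t ^ γ * psi Θ t)) Filter.atTop < ⊤})

/-- The individual Diophantine exponent `β(Θ)`, an element of `[0, +∞]`. -/
def individualExponent {m n : ℕ} (Θ : Matrix (Fin n) (Fin m) ℝ) : ℝ≥0∞ :=
  sSup (ENNReal.ofReal '' {γ : ℝ | 0 < γ ∧
    Filter.liminf (fun t : ℝ => ENNReal.ofReal (t ^ γ * psi Θ t)) Filter.atTop < ⊤})

/-- The function `g₃`, used for `1 ≤ a`. -/
def g3 (a : ℝ) : ℝ :=
  (1 - a + √((1 - a) ^ 2 + 4 * a * (2 * a ^ 2 - 2 * a + 1))) / (2 * a)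

end DiophantineExponents

end

/-! Let X_i and ζ_i be the norms and remainders of the best approximations z_i = (x_i, y_i) in ℤ⁴.
If γ > 1 is admissible for the uniform exponent, then ζ_i X_{i+1}^γ stays bounded; if β < b, then
ζ_i ≥ X_i^{-b} eventually. The theorem plays these two bounds against two facts from the geometry of
numbers.

Planes: up to constants, ζ_i X_{i+1} is the largest minor pairing a coordinate of x with a remainder
(`exists_le_minor`), and far out z_i, z_{i+1} form a basis of the integer points of their plane
(`exists_int_comb`). Hence ζ_i X_{i+1} is comparable for all consecutive pairs in one plane
(`mul_norm_le_of_mem_span`).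

Space: independence of 1 and the θ's keeps tails of (z_i) out of proper rational subspaces
(`exists_notMem_submodule`). So arbitrarily far out there are n < m with z_{n+1}, …, z_{m+1} in one
plane and z_n, z_m, z_{m+1}, z_{m+2} independent. Their determinant is a nonzero integer, whence 1 ≤
24 ζ_n ζ_m X_{m+1} X_{m+2}.

In logarithms all this is linear (`log_norm_bound`): X_{n+1} is bounded if (b - γ² + γ)(b - 1) <
γ²(γ - 1), which holds for γ ≤ b < γ g₃(γ). This is absurd for n large, and γ can be taken
arbitrarily close to α. -/

namespace DiophantineExponents

/-! ### Norms of integer vectors and of remainders -/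

/-- The vector of remainders `L_j(x) - y_j`. -/
def rem (Θ : Matrix (Fin 2) (Fin 2) ℝ) (x y : Fin 2 → ℤ) : Fin 2 → ℝ :=
  fun j => ∑ i, Θ j i * (x i : ℝ) - y j

theorem abs_apply_le_norm {ι : Type*} [Fintype ι] (v : ι → ℝ) (i : ι) : |v i| ≤ ‖v‖ :=
  norm_le_pi_norm v i

theorem exists_le_abs_of_le_norm {ι : Type*} [Fintype ι] [Nonempty ι] {v : ι → ℝ} {r : ℝ}
    (h : r ≤ ‖v‖) : ∃ i, r ≤ |v i| := by
  by_contra! hc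
  have hr : 0 < r := (abs_nonneg _).trans_lt (hc (Classical.arbitrary ι))
  exact absurd h (not_le.2 ((pi_norm_lt_iff hr).2 hc))

theorem norm_intCast (x : Fin 2 → ℤ) : ‖fun i => (x i : ℝ)‖ = ‖x‖ := by
  simp only [Pi.norm_def]
  congr 1

theorem abs_intCast_le_norm (x : Fin 2 → ℤ) (i : Fin 2) : |(x i : ℝ)| ≤ ‖x‖ := by
  rw [← norm_intCast]
  exact abs_apply_le_norm (fun i => (x i : ℝ)) i

theorem one_le_norm_of_ne_zero {x : Fin 2 → ℤ} (hx : x ≠ 0) : 1 ≤ ‖x‖ := by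
  obtain ⟨i, hi⟩ := Function.ne_iff.1 hx
  have h : (1 : ℤ) ≤ |x i| := Int.one_le_abs hi
  have h' : (1 : ℝ) ≤ |(x i : ℝ)| := by exact_mod_cast h
  exact h'.trans (abs_intCast_le_norm x i)

theorem finite_norm_le (R : ℝ) : {x : Fin 2 → ℤ | ‖x‖ ≤ R}.Finite := by
  refine ((Set.finite_Icc (fun _ : Fin 2 => -⌈R⌉) (fun _ => ⌈R⌉))).subset fun x hx => ?_
  have h : ∀ i, |x i| ≤ ⌈R⌉ := fun i => by
    have := (abs_intCast_le_norm x i).trans (hx.trans (Int.le_ceil R))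
    exact_mod_cast this
  exact ⟨fun i => (abs_le.1 (h i)).1, fun i => (abs_le.1 (h i)).2⟩

theorem rem_add_mul (Θ : Matrix (Fin 2) (Fin 2) ℝ) (x y x' y' : Fin 2 → ℤ) (s t : ℤ) (j : Fin 2) :
    rem Θ (fun i => s * x i + t * x' i) (fun i => s * y i + t * y' i) j
      = s * rem Θ x y j + t * rem Θ x' y' j := by
  simp only [rem, Fin.sum_univ_two]
  push_cast
  ring

theorem zeta_le_norm_rem (Θ : Matrix (Fin 2) (Fin 2) ℝ) (x y : Fin 2 → ℤ) :
    zeta Θ x ≤ ‖rem Θ x y‖ := by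
  refine (pi_norm_le_iff_of_nonneg (norm_nonneg _)).2 fun j => ?_
  rw [Real.norm_eq_abs, distInt, abs_abs]
  exact (round_le _ _).trans (abs_apply_le_norm (rem Θ x y) j)

/-- The vector of integers nearest to `L_j(x)`. -/
noncomputable def nearest (Θ : Matrix (Fin 2) (Fin 2) ℝ) (x : Fin 2 → ℤ) : Fin 2 → ℤ :=
  fun j => round (∑ i, Θ j i * (x i : ℝ))

theorem norm_rem_nearest (Θ : Matrix (Fin 2) (Fin 2) ℝ) (x : Fin 2 → ℤ) :
    ‖rem Θ x (nearest Θ x)‖ = zeta Θ x := by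
  refine le_antisymm ?_ (zeta_le_norm_rem Θ x _)
  refine (pi_norm_le_iff_of_nonneg (norm_nonneg _)).2 fun j => ?_
  have := abs_apply_le_norm (fun j => distInt (∑ i, Θ j i * (x i : ℝ))) j
  rw [distInt, abs_abs] at this
  exact this

/-! ### Lower bound for mixed minors -/

/-- The mixed minors of a pair of vectors `(X, E)`, `(X', E')` with `‖X‖ ≤ ‖X'‖`, `‖E'‖ ≤ ‖E‖`
are not all small, provided that neither of their sum and difference is small. -/
theorem exists_le_mixed_minor_aux {X X' E E' : Fin 2 → ℝ} {a : Fin 2} (ha : ‖X'‖ ≤ |X' a|)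
    (hX : ‖X‖ ≤ ‖X'‖) (hE : ‖E'‖ ≤ ‖E‖) (hs : 0 ≤ X a * X' a)
    (hmin : ‖X'‖ ≤ ‖X' - X‖ ∨ ‖E‖ ≤ ‖E' - E‖) :
    ∃ a b, ‖E‖ * ‖X'‖ ≤ 3 * |X a * E' b - X' a * E b| := by
  obtain ⟨b, hb⟩ := exists_le_abs_of_le_norm (v := E) le_rfl
  by_cases h : ‖E‖ * ‖X'‖ ≤ 3 * |X a * E' b - X' a * E b|
  · exact ⟨a, b, h⟩
  have n1 := norm_nonneg X'
  have n2 := norm_nonneg E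
  have eX : |X' a| = ‖X'‖ := le_antisymm (abs_apply_le_norm _ _) ha
  have eE : |E b| = ‖E‖ := le_antisymm (abs_apply_le_norm _ _) hb
  have hXa : |X a| ≤ ‖X'‖ := (abs_apply_le_norm _ _).trans hX
  have hEb : |E' b| ≤ ‖E‖ := (abs_apply_le_norm _ _).trans hE
  -- The term X'_a E_b has full size and the minor is under a third of it, so the other term has at
  -- least two thirds; hence so do both of its factors.
  have hbig : 2 * (‖E‖ * ‖X'‖) ≤ 3 * (|X a| * |E' b|) := by
    have := abs_sub_abs_le_abs_sub (X' a * E b) (X a * E' b)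
    rw [abs_mul, abs_mul, eX, eE, abs_sub_comm] at this
    nlinarith
  have npos : 0 < ‖E‖ * ‖X'‖ := by
    rcases (mul_nonneg n2 n1).eq_or_lt with h0 | h0
    · exact absurd (h0 ▸ by positivity) h
    · exact h0
  have hX' : 0 < ‖X'‖ := pos_of_mul_pos_right npos n2
  have hE' : 0 < ‖E‖ := pos_of_mul_pos_left npos n1
  have hXa2 : 2 * ‖X'‖ ≤ 3 * |X a| := by
    refine le_of_mul_le_mul_left ?_ hE'
    nlinarith [mul_le_mul_of_nonneg_left hEb (abs_nonneg (X a))]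
  have hEb2 : 2 * ‖E‖ ≤ 3 * |E' b| := by
    refine le_of_mul_le_mul_right ?_ hX'
    nlinarith [mul_le_mul_of_nonneg_right hXa (abs_nonneg (E' b))]
  have hXd : 3 * |X' a - X a| ≤ ‖X'‖ := by
    rcases le_total 0 (X' a) with h1 | h1
    · have h2 : 0 ≤ X a := by
        rcases h1.eq_or_lt with h3 | h3
        · rw [← h3, abs_zero] at eX; linarith
        · exact nonneg_of_mul_nonneg_left hs h3
      rw [abs_of_nonneg h1] at eX
      rw [abs_of_nonneg h2] at hXa hXa2
      rw [abs_of_nonneg (by linarith)]; linarith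
    · have h2 : X a ≤ 0 := by
        rcases h1.eq_or_lt with h3 | h3
        · rw [h3, abs_zero] at eX; linarith
        · nlinarith
      rw [abs_of_nonpos h1] at eX
      rw [abs_of_nonpos h2] at hXa hXa2
      rw [abs_of_nonpos (by linarith)]; linarith
  -- With opposite signs the two terms of the minor would add up instead of cancelling.
  have hsE : 0 < E' b * E b := by
    by_contra! hneg
    apply h
    have h3 : (X a * E' b) * (X' a * E b) ≤ 0 := by nlinarith
    have h4 : |X' a * E b| ≤ |X a * E' b - X' a * E b| := by
      apply sq_le_sq.1
      nlinarith [sq_nonneg (X a * E' b)]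
    rw [abs_mul, eX, eE] at h4
    linarith
  have hEd : 3 * |E' b - E b| ≤ ‖E‖ := by
    rcases pos_and_pos_or_neg_and_neg_of_mul_pos hsE with ⟨h1, h2⟩ | ⟨h1, h2⟩
    · rw [abs_of_pos h2] at eE
      rw [abs_of_pos h1] at hEb hEb2
      rw [abs_of_nonpos (by linarith)]; linarith
    · rw [abs_of_neg h2] at eE
      rw [abs_of_neg h1] at hEb hEb2
      rw [abs_of_nonneg (by linarith)]; linarith
  -- The pairs now agree within a third in coordinates a and b. A coordinate where the difference
  -- has full size gives a minor with one term at least 2/3 and the other at most 1/3.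
  rcases hmin with hm | hm
  · obtain ⟨a', ha'⟩ := exists_le_abs_of_le_norm hm
    refine ⟨a', b, ?_⟩
    have e : X a' * E' b - X' a' * E b = X' a' * (E' b - E b) - (X' - X) a' * E' b := by
      simp only [Pi.sub_apply]; ring
    have := abs_sub_abs_le_abs_sub ((X' - X) a' * E' b) (X' a' * (E' b - E b))
    rw [e, abs_sub_comm]
    rw [abs_mul, abs_mul] at this
    have h5 := mul_le_mul ha' hEb2 (by positivity) (abs_nonneg _)
    have h6 := mul_le_mul (abs_apply_le_norm X' a') hEd (by positivity) n1
    linarith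
  · obtain ⟨b', hb'⟩ := exists_le_abs_of_le_norm hm
    refine ⟨a, b', ?_⟩
    have e : X a * E' b' - X' a * E b' = X a * (E' - E) b' - (X' a - X a) * E b' := by
      simp only [Pi.sub_apply]; ring
    have := abs_sub_abs_le_abs_sub (X a * (E' - E) b') ((X' a - X a) * E b')
    rw [e]
    rw [abs_mul, abs_mul] at this
    have h5 := mul_le_mul hXa2 hb' n2 (by positivity)
    have h6 := mul_le_mul hXd (abs_apply_le_norm E b') (by positivity) n1
    linarith

theorem exists_le_mixed_minor {X X' E E' : Fin 2 → ℝ}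
    (hX : ‖X‖ ≤ ‖X'‖) (hE : ‖E'‖ ≤ ‖E‖)
    (hsub : ‖X'‖ ≤ ‖X' - X‖ ∨ ‖E‖ ≤ ‖E' - E‖) (hadd : ‖X'‖ ≤ ‖X' + X‖ ∨ ‖E‖ ≤ ‖E' + E‖) :
    ∃ a b, ‖E‖ * ‖X'‖ ≤ 3 * |X a * E' b - X' a * E b| := by
  obtain ⟨a, ha⟩ := exists_le_abs_of_le_norm (v := X') le_rfl
  rcases le_total 0 (X a * X' a) with h | h
  · exact exists_le_mixed_minor_aux ha hX hE h hsub
  · obtain ⟨a', b', h'⟩ := exists_le_mixed_minor_aux (X := -X) (E := -E) (E' := E') ha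
      (by rwa [norm_neg])
      (by rwa [norm_neg]) (by rw [Pi.neg_apply, neg_mul]; linarith)
      (by simpa only [norm_neg, sub_neg_eq_add] using hadd)
    refine ⟨a', b', ?_⟩
    rw [norm_neg, ← abs_neg] at h'
    convert h' using 3
    simp only [Pi.neg_apply]; ring

/-! ### Consecutive best approximations -/

/-- A sequence of best approximations for `Θ`. -/
structure IsBestSeq (Θ : Matrix (Fin 2) (Fin 2) ℝ) (x y : ℕ → Fin 2 → ℤ) : Prop where
  ne_zero : ∀ i, x i ≠ 0
  norm_lt : ∀ i, ‖x i‖ < ‖x (i + 1)‖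
  rem_lt : ∀ i, ‖rem Θ (x (i + 1)) (y (i + 1))‖ < ‖rem Θ (x i) (y i)‖
  minimal : ∀ i u v, u ≠ 0 → ‖u‖ < ‖x (i + 1)‖ → ‖rem Θ (x i) (y i)‖ ≤ ‖rem Θ u v‖

namespace IsBestSeq

variable {Θ : Matrix (Fin 2) (Fin 2) ℝ} {x y : ℕ → Fin 2 → ℤ}

theorem strictMono_norm (h : IsBestSeq Θ x y) : StrictMono fun i => ‖x i‖ :=
  strictMono_nat_of_lt_succ h.norm_lt

theorem strictAnti_rem (h : IsBestSeq Θ x y) : StrictAnti fun i => ‖rem Θ (x i) (y i)‖ :=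
  strictAnti_nat_of_succ_lt h.rem_lt

/-- The point z_{i+1} ± z_i is itself a competitor in the minimality condition; its integer part is
nonzero because the two norms differ. -/
theorem minimal_comb (h : IsBestSeq Θ x y) (i : ℕ) (s : ℤ) (hs : |s| = 1) :
    ‖x (i + 1)‖ ≤ ‖fun j => (x (i + 1) j : ℝ) + s * x i j‖ ∨
    ‖rem Θ (x i) (y i)‖ ≤
      ‖fun j => rem Θ (x (i + 1)) (y (i + 1)) j + s * rem Θ (x i) (y i) j‖ := by
  by_contra! hc
  obtain ⟨h1, h2⟩ := hc
  set u : Fin 2 → ℤ := fun j => 1 * x (i + 1) j + s * x i j with hu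
  have e1 : ‖u‖ = ‖fun j => (x (i + 1) j : ℝ) + s * x i j‖ := by
    rw [← norm_intCast]; congr 1; ext j; simp [hu]
  have hu0 : u ≠ 0 := by
    intro h0
    have hj : ∀ j, x (i + 1) j = -s * x i j := fun j => by
      have := congrFun h0 j
      simp only [hu, Pi.zero_apply] at this
      linarith
    refine absurd (h.norm_lt i) (not_lt.2 ?_)
    refine (pi_norm_le_iff_of_nonneg (norm_nonneg _)).2 fun j => ?_
    rw [hj, Int.norm_eq_abs, Int.cast_mul, abs_mul, ← Int.cast_abs, abs_neg, hs, Int.cast_one,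
      one_mul]
    exact abs_intCast_le_norm _ _
  have := h.minimal i u (fun j => 1 * y (i + 1) j + s * y i j) hu0 (e1 ▸ h1)
  refine absurd this (not_le.2 ?_)
  convert h2 using 2
  ext j
  rw [rem_add_mul]
  push_cast; ring

theorem exists_le_minor (h : IsBestSeq Θ x y) (i : ℕ) :
    ∃ a b, ‖rem Θ (x i) (y i)‖ * ‖x (i + 1)‖ ≤ 3 * |x i a * rem Θ (x (i + 1)) (y (i + 1)) b
      - x (i + 1) a * rem Θ (x i) (y i) b| := by
  have := exists_le_mixed_minor (X := fun j => (x i j : ℝ)) (X' := fun j => (x (i + 1) j : ℝ))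
    (E := rem Θ (x i) (y i)) (E' := rem Θ (x (i + 1)) (y (i + 1)))
    (by rw [norm_intCast, norm_intCast]; exact (h.norm_lt i).le) (h.rem_lt i).le
    (by
      rw [norm_intCast]
      convert h.minimal_comb i (-1) (by norm_num) using 3
      · ext j; simp [sub_eq_add_neg]
      · ext j; simp [sub_eq_add_neg])
    (by
      rw [norm_intCast]
      convert h.minimal_comb i 1 (by norm_num) using 3 <;>
      · congr 1; ext j; simp)
  rwa [norm_intCast] at this

end IsBestSeq

end DiophantineExponents

/-! ### Four independent approximations and their determinant -/

namespace DiophantineExponents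

open Module Submodule

/-- A sequence of vectors in a four-dimensional space with no tail in a proper subspace, whose
consecutive terms are independent, changes the three-dimensional span of consecutive terms. -/
theorem exists_linearIndependent_four {V : Type*} [AddCommGroup V] [Module ℚ V]
    [FiniteDimensional ℚ V]
    (hV : finrank ℚ V = 4) {z : ℕ → V} {N : ℕ}
    (hz : ∀ i, N ≤ i → LinearIndependent ℚ ![z i, z (i + 1)])
    (hW : ∀ W : Submodule ℚ V, W ≠ ⊤ → ∃ i, N ≤ i ∧ z i ∉ W) :
    ∃ n m, N ≤ n ∧ n + 1 ≤ m ∧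
      (∀ i, n + 1 ≤ i → i ≤ m + 1 → z i ∈ span ℚ (Set.range ![z m, z (m + 1)])) ∧
      LinearIndependent ℚ ![z (m + 2), z n, z m, z (m + 1)] := by
  classical
  have key : ∀ {k : ℕ} (v : Fin k → V), k < 4 → span ℚ (Set.range v) ≠ ⊤ := by
    intro k v hk h
    have h1 := finrank_range_le_card (R := ℚ) v
    rw [Set.finrank, h, finrank_top, hV, Fintype.card_fin] at h1
    omega
  -- Here j is the first index leaving the initial plane, S the resulting three-dimensional space,
  -- and l = m + 2 the first index leaving S.
  set U := span ℚ (Set.range ![z N, z (N + 1)]) with hU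
  have hUj := hW U (key _ (by norm_num))
  set j := Nat.find hUj with hj
  obtain ⟨hNj, hjU⟩ := Nat.find_spec hUj
  rw [← hj] at hNj hjU
  have hjmin : ∀ i, N ≤ i → i < j → z i ∈ U := fun i h1 h2 => by
    by_contra h3
    exact Nat.find_min hUj h2 ⟨h1, h3⟩
  have hN0 : z N ∈ U := subset_span ⟨0, rfl⟩
  have hN1 : z (N + 1) ∈ U := subset_span ⟨1, rfl⟩
  have hj2 : N + 2 ≤ j := by
    by_contra h
    have : j = N ∨ j = N + 1 := by omega
    rcases this with h | h <;> rw [h] at hjU <;> contradiction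
  set S := span ℚ (Set.range ![z j, z N, z (N + 1)]) with hS
  have hUS : U ≤ S := span_mono (by
    rintro _ ⟨i, rfl⟩
    fin_cases i
    exacts [⟨1, rfl⟩, ⟨2, rfl⟩])
  have hSl := hW S (key _ (by norm_num))
  set l := Nat.find hSl with hl
  obtain ⟨hNl, hlS⟩ := Nat.find_spec hSl
  rw [← hl] at hNl hlS
  have hlmin : ∀ i, N ≤ i → i < l → z i ∈ S := fun i h1 h2 => by
    by_contra h3
    exact Nat.find_min hSl h2 ⟨h1, h3⟩
  have hjl : j < l := by
    by_contra! h
    rcases h.eq_or_lt with h | h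
    · rw [h] at hlS
      exact hlS (subset_span ⟨0, rfl⟩)
    · exact hlS (hUS (hjmin l hNl h))
  clear_value l
  obtain ⟨m, rfl⟩ : ∃ m, l = m + 2 := ⟨l - 2, by omega⟩
  set P := span ℚ (Set.range ![z m, z (m + 1)]) with hP
  have hex : ∃ i, ∀ i', i ≤ i' → i' ≤ m + 1 → z i' ∈ P := ⟨m, fun i' h1 h2 => by
    have : i' = m ∨ i' = m + 1 := by omega
    rcases this with rfl | rfl
    · exact subset_span ⟨0, rfl⟩
    · exact subset_span ⟨1, rfl⟩⟩
  -- The run of terms in the plane P that ends at m + 1 is followed back to its first index ν; then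
  -- n = ν - 1.
  have hνm : Nat.find hex ≤ m := Nat.find_min' hex fun i' h1 h2 => by
    have : i' = m ∨ i' = m + 1 := by omega
    rcases this with rfl | rfl
    · exact subset_span ⟨0, rfl⟩
    · exact subset_span ⟨1, rfl⟩
  have hspec := Nat.find_spec hex
  have hmin := fun i => Nat.find_min (m := i) hex
  set ν := Nat.find hex
  have hνN : N < ν := by
    by_contra! h
    -- If the run reached back to N, then P would contain the three-dimensional S.
    have h3 : LinearIndependent ℚ ![z j, z N, z (N + 1)] :=
      linearIndependent_finCons.2 ⟨hz N le_rfl, hjU⟩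
    have h4 : S ≤ P := span_le.2 (by
      rintro _ ⟨i, rfl⟩
      fin_cases i
      exacts [hspec j (by omega) (by omega), hspec N h (by omega),
        hspec (N + 1) (by omega) (by omega)])
    have h5 := finrank_mono h4
    have h6 : finrank ℚ S = Fintype.card (Fin 3) := finrank_span_eq_card h3
    have h7 : finrank ℚ P ≤ Fintype.card (Fin 2) :=
      finrank_range_le_card (R := ℚ) ![z m, z (m + 1)]
    rw [Fintype.card_fin] at h6 h7
    omega
  obtain ⟨n, hn⟩ : ∃ n, ν = n + 1 := ⟨ν - 1, by omega⟩
  refine ⟨n, m, by omega, by omega, fun i h1 h2 => hspec i (by omega) h2, ?_⟩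
  have hnP : z n ∉ P := fun h => hmin n (by omega) fun i' h1 h2 => by
    rcases h1.eq_or_lt with rfl | h3
    · exact h
    · exact hspec i' (by omega) h2
  refine linearIndependent_finCons.2 ⟨linearIndependent_finCons.2 ⟨hz m (by omega), hnP⟩,
    fun h => hlS ((span_le.2 ?_ : _ ≤ S) h)⟩
  rintro _ ⟨i, rfl⟩
  fin_cases i
  exacts [hlmin n (by omega) (by omega), hlmin m (by omega) (by omega),
    hlmin (m + 1) (by omega) (by omega)]

/-- The rational vector `(x, y)`. -/
def vec (x y : Fin 2 → ℤ) : Fin 4 → ℚ := ![x 0, x 1, y 0, y 1]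

/-- Laplace expansion along the x-columns and the remainder columns: six products of 2 × 2 minors,
each at most 4 ‖e₀‖ ‖e₁‖ ‖x₂‖ ‖x₃‖ by monotonicity. -/
theorem abs_det_le {x₀ x₁ x₂ x₃ e₀ e₁ e₂ e₃ : Fin 2 → ℝ}
    (h01 : ‖x₀‖ ≤ ‖x₁‖) (h12 : ‖x₁‖ ≤ ‖x₂‖) (h23 : ‖x₂‖ ≤ ‖x₃‖)
    (k01 : ‖e₁‖ ≤ ‖e₀‖) (k12 : ‖e₂‖ ≤ ‖e₁‖) (k23 : ‖e₃‖ ≤ ‖e₂‖) :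
    |(x₀ 0 * x₁ 1 - x₁ 0 * x₀ 1) * (e₂ 0 * e₃ 1 - e₃ 0 * e₂ 1)
      - (x₀ 0 * x₂ 1 - x₂ 0 * x₀ 1) * (e₁ 0 * e₃ 1 - e₃ 0 * e₁ 1)
      + (x₀ 0 * x₃ 1 - x₃ 0 * x₀ 1) * (e₁ 0 * e₂ 1 - e₂ 0 * e₁ 1)
      + (x₁ 0 * x₂ 1 - x₂ 0 * x₁ 1) * (e₀ 0 * e₃ 1 - e₃ 0 * e₀ 1)
      - (x₁ 0 * x₃ 1 - x₃ 0 * x₁ 1) * (e₀ 0 * e₂ 1 - e₂ 0 * e₀ 1)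
      + (x₂ 0 * x₃ 1 - x₃ 0 * x₂ 1) * (e₀ 0 * e₁ 1 - e₁ 0 * e₀ 1)|
    ≤ 24 * (‖e₀‖ * ‖e₁‖ * (‖x₂‖ * ‖x₃‖)) := by
  have minor : ∀ {u v : Fin 2 → ℝ} {a b : ℝ}, ‖u‖ ≤ a → ‖v‖ ≤ b →
      |u 0 * v 1 - v 0 * u 1| ≤ 2 * (a * b) := by
    intro u v a b hu hv
    have ha := (norm_nonneg u).trans hu
    have h1 : |u 0 * v 1| ≤ a * b := by
      rw [abs_mul]
      exact mul_le_mul ((abs_apply_le_norm u 0).trans hu) ((abs_apply_le_norm v 1).trans hv)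
        (abs_nonneg _) ha
    have h2 : |v 0 * u 1| ≤ a * b := by
      rw [abs_mul, mul_comm]
      exact mul_le_mul ((abs_apply_le_norm u 1).trans hu) ((abs_apply_le_norm v 0).trans hv)
        (abs_nonneg _) ha
    exact (abs_sub _ _).trans (by linarith)
  have prod : ∀ {u v e f : Fin 2 → ℝ}, ‖u‖ ≤ ‖x₂‖ → ‖v‖ ≤ ‖x₃‖ → ‖e‖ ≤ ‖e₀‖ → ‖f‖ ≤ ‖e₁‖ →
      |(u 0 * v 1 - v 0 * u 1) * (e 0 * f 1 - f 0 * e 1)| ≤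
        4 * (‖e₀‖ * ‖e₁‖ * (‖x₂‖ * ‖x₃‖)) := by
    intro u v e f h1 h2 h3 h4
    rw [abs_mul]
    refine (mul_le_mul (minor h1 h2) (minor h3 h4) (abs_nonneg _) (by positivity)).trans_eq ?_
    ring
  have p1 := prod (u := x₀) (v := x₁) (e := e₂) (f := e₃) (by linarith) (by linarith) (by linarith)
    (by linarith)
  have p2 := prod (u := x₀) (v := x₂) (e := e₁) (f := e₃) (by linarith) (by linarith) (by linarith)
    (by linarith)
  have p3 := prod (u := x₀) (v := x₃) (e := e₁) (f := e₂) (by linarith) (by linarith) (by linarith)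
    (by linarith)
  have p4 := prod (u := x₁) (v := x₂) (e := e₀) (f := e₃) (by linarith) (by linarith) (by linarith)
    (by linarith)
  have p5 := prod (u := x₁) (v := x₃) (e := e₀) (f := e₂) (by linarith) (by linarith) (by linarith)
    (by linarith)
  have p6 := prod (u := x₂) (v := x₃) (e := e₀) (f := e₁) (by linarith) (by linarith) (by linarith)
    (by linarith)
  rw [abs_le] at *
  constructor <;> linarith [p1.1, p1.2, p2.1, p2.2, p3.1, p3.2, p4.1, p4.2, p5.1, p5.2, p6.1, p6.2]

theorem one_le_of_linearIndependent (Θ : Matrix (Fin 2) (Fin 2) ℝ)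
    {x₀ x₁ x₂ x₃ y₀ y₁ y₂ y₃ : Fin 2 → ℤ}
    (h : LinearIndependent ℚ ![vec x₃ y₃, vec x₀ y₀, vec x₁ y₁, vec x₂ y₂])
    (h01 : ‖x₀‖ ≤ ‖x₁‖) (h12 : ‖x₁‖ ≤ ‖x₂‖) (h23 : ‖x₂‖ ≤ ‖x₃‖)
    (k01 : ‖rem Θ x₁ y₁‖ ≤ ‖rem Θ x₀ y₀‖) (k12 : ‖rem Θ x₂ y₂‖ ≤ ‖rem Θ x₁ y₁‖)
    (k23 : ‖rem Θ x₃ y₃‖ ≤ ‖rem Θ x₂ y₂‖) :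
    1 ≤ 24 * (‖rem Θ x₀ y₀‖ * ‖rem Θ x₁ y₁‖ * (‖x₂‖ * ‖x₃‖)) := by
  set D : ℤ := (x₀ 0 * x₁ 1 - x₁ 0 * x₀ 1) * (y₂ 0 * y₃ 1 - y₃ 0 * y₂ 1)
      - (x₀ 0 * x₂ 1 - x₂ 0 * x₀ 1) * (y₁ 0 * y₃ 1 - y₃ 0 * y₁ 1)
      + (x₀ 0 * x₃ 1 - x₃ 0 * x₀ 1) * (y₁ 0 * y₂ 1 - y₂ 0 * y₁ 1)
      + (x₁ 0 * x₂ 1 - x₂ 0 * x₁ 1) * (y₀ 0 * y₃ 1 - y₃ 0 * y₀ 1)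
      - (x₁ 0 * x₃ 1 - x₃ 0 * x₁ 1) * (y₀ 0 * y₂ 1 - y₂ 0 * y₀ 1)
      + (x₂ 0 * x₃ 1 - x₃ 0 * x₂ 1) * (y₀ 0 * y₁ 1 - y₁ 0 * y₀ 1) with hD
  have hdet : (Matrix.of ![vec x₃ y₃, vec x₀ y₀, vec x₁ y₁, vec x₂ y₂]).det = -(D : ℚ) := by
    simp [Matrix.det_succ_row_zero, Fin.sum_univ_succ, vec, hD, Fin.succAbove]
    ring
  have hD0 : D ≠ 0 := by
    intro h0
    have h1 : IsUnit (Matrix.of ![vec x₃ y₃, vec x₀ y₀, vec x₁ y₁, vec x₂ y₂]) :=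
      Matrix.linearIndependent_rows_iff_isUnit.1 h
    rw [Matrix.isUnit_iff_isUnit_det, hdet, h0] at h1
    simp at h1
  have h1 : (1 : ℝ) ≤ |(D : ℝ)| := by exact_mod_cast Int.one_le_abs hD0
  have h2 := abs_det_le (x₀ := fun i => (x₀ i : ℝ)) (x₁ := fun i => (x₁ i : ℝ))
    (x₂ := fun i => (x₂ i : ℝ)) (x₃ := fun i => (x₃ i : ℝ))
    (by simpa only [norm_intCast]) (by simpa only [norm_intCast]) (by simpa only [norm_intCast])
    k01 k12 k23
  -- Passing from y to L(x) - y is a column operation with two sign changes, so the determinant is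
  -- the same integer D.
  rw [norm_intCast, norm_intCast] at h2
  refine (h1.trans_eq ?_).trans h2
  congr 1
  simp only [hD, rem, Fin.sum_univ_two]
  push_cast
  ring

theorem linearIndependent_vec {x y x' y' : Fin 2 → ℤ} (h : x 0 * x' 1 - x' 0 * x 1 ≠ 0) :
    LinearIndependent ℚ ![vec x y, vec x' y'] := by
  rw [LinearIndependent.pair_iff]
  intro s t hst
  have h0 := congrFun hst 0
  have h1 := congrFun hst 1
  simp [vec] at h0 h1
  have hd : (x 0 * x' 1 - x' 0 * x 1 : ℚ) ≠ 0 := by exact_mod_cast h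
  constructor
  · refine (mul_eq_zero.1 ?_).resolve_right hd
    linear_combination (x' 1 : ℚ) * h0 - (x' 0 : ℚ) * h1
  · refine (mul_eq_zero.1 ?_).resolve_right hd
    linear_combination (-x 1 : ℚ) * h0 + (x 0 : ℚ) * h1

/-! ### Consecutive approximations as a lattice basis -/

namespace IsBestSeq

variable {Θ : Matrix (Fin 2) (Fin 2) ℝ} {x y : ℕ → Fin 2 → ℤ}

theorem rem_pos (h : IsBestSeq Θ x y) (i : ℕ) : 0 < ‖rem Θ (x i) (y i)‖ :=
  (norm_nonneg _).trans_lt (h.rem_lt i)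

theorem norm_pos (h : IsBestSeq Θ x y) (i : ℕ) : 0 < ‖x i‖ := norm_pos_iff.2 (h.ne_zero i)

theorem abs_minor_le (h : IsBestSeq Θ x y) (i : ℕ) (a b : Fin 2) :
    |x i a * rem Θ (x (i + 1)) (y (i + 1)) b - x (i + 1) a * rem Θ (x i) (y i) b| ≤
      2 * (‖rem Θ (x i) (y i)‖ * ‖x (i + 1)‖) := by
  have h1 := mul_le_mul ((abs_intCast_le_norm (x i) a).trans (h.norm_lt i).le)
    ((abs_apply_le_norm (rem Θ (x (i + 1)) (y (i + 1))) b).trans (h.rem_lt i).le)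
    (abs_nonneg _) (h.norm_pos _).le
  have h2 := mul_le_mul (abs_intCast_le_norm (x (i + 1)) a)
    (abs_apply_le_norm (rem Θ (x i) (y i)) b) (abs_nonneg _) (h.norm_pos _).le
  rw [← abs_mul] at h1 h2
  exact (abs_sub _ _).trans (by linarith)

/-- If this determinant vanished, Θ would cancel from every mixed minor, leaving integers of
absolute value below 1. All would be zero, against `exists_le_minor`. -/
theorem det_ne_zero (h : IsBestSeq Θ x y) {i : ℕ}
    (hi : 2 * (‖rem Θ (x i) (y i)‖ * ‖x (i + 1)‖) < 1) :
    x i 0 * x (i + 1) 1 - x (i + 1) 0 * x i 1 ≠ 0 := by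
  intro hd
  obtain ⟨a, b, hab⟩ := h.exists_le_minor i
  have hle := (h.abs_minor_le i a b).trans_lt hi
  set m := x i a * rem Θ (x (i + 1)) (y (i + 1)) b - x (i + 1) a * rem Θ (x i) (y i) b with hm
  have hda : ∀ c, (x i a * x (i + 1) c - x (i + 1) a * x i c : ℝ) = 0 := by
    intro c
    have hd' : (x i 0 * x (i + 1) 1 - x (i + 1) 0 * x i 1 : ℝ) = 0 := by exact_mod_cast hd
    fin_cases a <;> fin_cases c <;> simp <;> linarith
  have hint : m = ((x (i + 1) a * y i b - x i a * y (i + 1) b : ℤ) : ℝ) := by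
    simp only [hm, rem, Fin.sum_univ_two]
    push_cast
    linear_combination Θ b 0 * hda 0 + Θ b 1 * hda 1
  rw [hint] at hle hab
  have h0 : x (i + 1) a * y i b - x i a * y (i + 1) b = 0 := by
    rw [← Int.abs_lt_one_iff]
    exact_mod_cast hle
  rw [h0] at hab
  have := mul_pos (h.rem_pos i) (h.norm_pos (i + 1))
  simp at hab
  linarith

/-- Rounding the coefficients leaves an integer point with coefficients at most 1/2. Its norm is
below X_{i+1} and its remainder below ζ_i, so minimality forces its x-part to vanish. -/
theorem exists_int_comb (h : IsBestSeq Θ x y) {i : ℕ}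
    (hd : x i 0 * x (i + 1) 1 - x (i + 1) 0 * x i 1 ≠ 0) {u v : Fin 2 → ℤ} {r r' : ℝ}
    (hu : ∀ j, (u j : ℝ) = r * x i j + r' * x (i + 1) j)
    (hv : ∀ j, (v j : ℝ) = r * y i j + r' * y (i + 1) j) :
    ∃ s t : ℤ, (∀ j, u j = s * x i j + t * x (i + 1) j) ∧
      ∀ j, v j = s * y i j + t * y (i + 1) j := by
  set s := round r
  set t := round r'
  set u' : Fin 2 → ℤ := fun j => u j - (s * x i j + t * x (i + 1) j) with hu'
  set v' : Fin 2 → ℤ := fun j => v j - (s * y i j + t * y (i + 1) j) with hv'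
  have hr : |r - s| ≤ 1 / 2 := abs_sub_round r
  have hr' : |r' - t| ≤ 1 / 2 := abs_sub_round r'
  have eu : ∀ j, (u' j : ℝ) = (r - s) * x i j + (r' - t) * x (i + 1) j := fun j => by
    simp only [hu']; push_cast; rw [hu]; ring
  have ev : ∀ j, (v' j : ℝ) = (r - s) * y i j + (r' - t) * y (i + 1) j := fun j => by
    simp only [hv']; push_cast; rw [hv]; ring
  have bound : ∀ {p q P Q : ℝ}, |p| ≤ P → |q| ≤ Q →
      |(r - s) * p + (r' - t) * q| ≤ 1 / 2 * P + 1 / 2 * Q := by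
    intro p q P Q hp hq
    refine (abs_add_le _ _).trans ?_
    rw [abs_mul, abs_mul]
    exact add_le_add (mul_le_mul hr hp (abs_nonneg _) (by norm_num))
      (mul_le_mul hr' hq (abs_nonneg _) (by norm_num))
  have hu0 : u' = 0 := by
    by_contra hne
    have h1 : ‖u'‖ < ‖x (i + 1)‖ := by
      rw [← norm_intCast]
      refine (pi_norm_lt_iff (h.norm_pos _)).2 fun j => ?_
      rw [Real.norm_eq_abs, eu]
      refine (bound (abs_intCast_le_norm (x i) j) (abs_intCast_le_norm (x (i + 1)) j)).trans_lt ?_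
      linarith [h.norm_lt i]
    refine absurd (h.minimal i u' v' hne h1) (not_le.2 ?_)
    refine (pi_norm_lt_iff (h.rem_pos _)).2 fun j => ?_
    have e : rem Θ u' v' j = (r - s) * rem Θ (x i) (y i) j
        + (r' - t) * rem Θ (x (i + 1)) (y (i + 1)) j := by
      simp only [rem, Fin.sum_univ_two, eu, ev]; ring
    rw [Real.norm_eq_abs, e]
    refine (bound (abs_apply_le_norm _ j) (abs_apply_le_norm _ j)).trans_lt ?_
    linarith [h.rem_lt i]
  have hd' : (x i 0 * x (i + 1) 1 - x (i + 1) 0 * x i 1 : ℝ) ≠ 0 := by exact_mod_cast hd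
  have e0 := eu 0
  have e1 := eu 1
  simp only [hu0, Pi.zero_apply, Int.cast_zero] at e0 e1
  have hs : r - s = 0 := by
    refine (mul_eq_zero.1 ?_).resolve_right hd'
    linear_combination -(x (i + 1) 1 : ℝ) * e0 + (x (i + 1) 0 : ℝ) * e1
  have ht : r' - t = 0 := by
    refine (mul_eq_zero.1 ?_).resolve_right hd'
    linear_combination (x i 1 : ℝ) * e0 - (x i 0 : ℝ) * e1
  refine ⟨s, t, fun j => ?_, fun j => ?_⟩
  · have := congrFun hu0 j
    simp only [hu', Pi.zero_apply] at this
    linarith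
  · have := ev j
    rw [hs, ht, zero_mul, zero_mul, add_zero] at this
    have := Int.cast_eq_zero.1 this
    simp only [hv'] at this
    linarith

end IsBestSeq

end DiophantineExponents

/-! ### Rational subspaces met by the sequence -/

namespace DiophantineExponents

open Module Submodule

theorem eq_zero_of_linear_relation {Θ : Matrix (Fin 2) (Fin 2) ℝ}
    (hΘ : LinearIndependent ℤ
      (fun o : Option (Fin 2 × Fin 2) => o.elim (1 : ℝ) (fun p => Θ p.1 p.2)))
    (p : ℚ) (q : Fin 2 → Fin 2 → ℚ) (h : (p : ℝ) + ∑ i, ∑ j, q i j * Θ i j = 0) :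
    p = 0 ∧ ∀ i j, q i j = 0 := by
  have hQ := (LinearIndependent.iff_fractionRing ℤ ℚ).1 hΘ
  rw [Fintype.linearIndependent_iff] at hQ
  have := hQ (fun o => o.elim p fun r => q r.1 r.2) (by
    rw [Fintype.sum_option, Fintype.sum_prod_type]
    simpa [Rat.smul_def] using h)
  exact ⟨this none, fun i j => this (some (i, j))⟩

theorem column_relation {Θ : Matrix (Fin 2) (Fin 2) ℝ}
    (hΘ : LinearIndependent ℤ
      (fun o : Option (Fin 2 × Fin 2) => o.elim (1 : ℝ) (fun p => Θ p.1 p.2)))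
    (c : Fin 2) (p q r : ℚ) (h : (p : ℝ) + q * Θ 0 c + r * Θ 1 c = 0) : p = 0 ∧ q = 0 ∧ r = 0 := by
  obtain ⟨h0, h1⟩ := eq_zero_of_linear_relation hΘ p
    (fun i j => if j = c then (if i = 0 then q else r) else 0) (by
      rw [← h]
      fin_cases c <;> simp [Fin.sum_univ_two] <;> ring)
  exact ⟨h0, by simpa using h1 0 c, by simpa using h1 1 c⟩

theorem zeta_pos {Θ : Matrix (Fin 2) (Fin 2) ℝ}
    (hΘ : LinearIndependent ℤ
      (fun o : Option (Fin 2 × Fin 2) => o.elim (1 : ℝ) (fun p => Θ p.1 p.2)))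
    {x : Fin 2 → ℤ} (hx : x ≠ 0) : 0 < zeta Θ x := by
  rw [← norm_rem_nearest, norm_pos_iff]
  intro h0
  have h := congrFun h0 0
  simp only [rem, Pi.zero_apply, Fin.sum_univ_two] at h
  obtain ⟨-, h1⟩ := eq_zero_of_linear_relation hΘ (-nearest Θ x 0 : ℤ)
    (fun i j => if i = 0 then (x j : ℚ) else 0) (by
      simp [Fin.sum_univ_two]
      linarith)
  exact hx (funext fun j => by simpa using h1 0 j)

namespace IsBestSeq

variable {Θ : Matrix (Fin 2) (Fin 2) ℝ} {x y : ℕ → Fin 2 → ℤ}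

/-- A rational form vanishing on a tail becomes, on replacing y by L(x) minus the remainder, a
nonzero real form in x that is O(ζ_i) at x_i. Two consecutive values determine its coefficients by
Cramer's rule, with error O(ζ_i X_{i+1}), which tends to 0. -/
theorem exists_notMem_submodule (h : IsBestSeq Θ x y)
    (hΘ : LinearIndependent ℤ
      (fun o : Option (Fin 2 × Fin 2) => o.elim (1 : ℝ) (fun p => Θ p.1 p.2)))
    (hlim : Filter.Tendsto (fun i => ‖rem Θ (x i) (y i)‖ * ‖x (i + 1)‖) Filter.atTop (nhds 0))
    (W : Submodule ℚ (Fin 4 → ℚ)) (hW : W ≠ ⊤) (N : ℕ) :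
    ∃ i, N ≤ i ∧ vec (x i) (y i) ∉ W := by
  by_contra! hc
  obtain ⟨f, hf0, hf⟩ := Submodule.exists_le_ker_of_lt_top W hW.lt_top
  obtain ⟨a, ha⟩ : ∃ a : Fin 4 → ℚ, ∀ w, f w = ∑ j, w j * a j :=
    ⟨fun j => f fun k => if j = k then 1 else 0, fun w => LinearMap.pi_apply_eq_sum_univ f w⟩
  obtain ⟨c, hcol⟩ : ∃ c : Fin 2,
      ((if c = 0 then a 0 else a 1 : ℚ) : ℝ) + a 2 * Θ 0 c + a 3 * Θ 1 c ≠ 0 := by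
    by_contra! h0
    obtain ⟨h1, h2, h3⟩ := column_relation hΘ 0 _ _ _ (h0 0)
    obtain ⟨h4, -, -⟩ := column_relation hΘ 1 _ _ _ (h0 1)
    apply hf0
    ext w
    simp at h1 h4
    simp [ha, Fin.sum_univ_four, h1, h2, h3, h4]
  set hh : Fin 2 → ℝ := fun c =>
    ((if c = 0 then a 0 else a 1 : ℚ) : ℝ) + a 2 * Θ 0 c + a 3 * Θ 1 c with hhh
  set K : ℝ := |(a 2 : ℝ)| + |(a 3 : ℝ)| with hK
  have hform : ∀ i, N ≤ i → |hh 0 * x i 0 + hh 1 * x i 1| ≤ K * ‖rem Θ (x i) (y i)‖ := by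
    intro i hi
    have h0 := LinearMap.mem_ker.1 (hf (hc i hi))
    rw [ha, Fin.sum_univ_four] at h0
    simp only [vec] at h0
    have h1 : (x i 0 * a 0 + x i 1 * a 1 + y i 0 * a 2 + y i 1 * a 3 : ℝ) = 0 := by
      exact_mod_cast h0
    have e : hh 0 * x i 0 + hh 1 * x i 1
        = a 2 * rem Θ (x i) (y i) 0 + a 3 * rem Θ (x i) (y i) 1 := by
      simp [hhh, rem, Fin.sum_univ_two]
      linear_combination h1
    rw [e, hK, add_mul]
    refine (abs_add_le _ _).trans ?_
    rw [abs_mul, abs_mul]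
    gcongr <;> exact abs_apply_le_norm _ _
  have hev : ∀ᶠ i in Filter.atTop, 2 * (‖rem Θ (x i) (y i)‖ * ‖x (i + 1)‖) < 1 :=
    (hlim.const_mul 2).eventually_lt_const (by norm_num)
  have hev2 : ∀ᶠ i in Filter.atTop,
      2 * K * (‖rem Θ (x i) (y i)‖ * ‖x (i + 1)‖) < |hh c| :=
    (hlim.const_mul (2 * K)).eventually_lt_const (by simpa using hcol)
  obtain ⟨i, h1, h2, hi⟩ := (hev.and (hev2.and (Filter.eventually_ge_atTop N))).exists
  have hd : (1 : ℝ) ≤ |(x i 0 * x (i + 1) 1 - x (i + 1) 0 * x i 1 : ℝ)| := by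
    exact_mod_cast Int.one_le_abs (h.det_ne_zero h1)
  have hK0 : 0 ≤ K := by positivity
  have f0 := hform i hi
  have f1 := (hform (i + 1) (by omega)).trans (mul_le_mul_of_nonneg_left (h.rem_lt i).le hK0)
  have bound : ∀ j, |(hh 0 * x i 0 + hh 1 * x i 1) * x (i + 1) j
      - (hh 0 * x (i + 1) 0 + hh 1 * x (i + 1) 1) * x i j| ≤
      2 * K * (‖rem Θ (x i) (y i)‖ * ‖x (i + 1)‖) := by
    intro j
    refine (abs_sub _ _).trans ?_
    rw [abs_mul, abs_mul]
    have g0 := mul_le_mul f0 (abs_intCast_le_norm (x (i + 1)) j) (abs_nonneg _)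
      (mul_nonneg hK0 (norm_nonneg _))
    have g1 := mul_le_mul f1 ((abs_intCast_le_norm (x i) j).trans (h.norm_lt i).le) (abs_nonneg _)
      (mul_nonneg hK0 (norm_nonneg _))
    linarith
  -- The Cramer determinant is a nonzero integer, so multiplying by it cannot decrease |h_c|.
  have hle : |hh c| ≤ |hh c * (x i 0 * x (i + 1) 1 - x (i + 1) 0 * x i 1)| := by
    rw [abs_mul]
    exact le_mul_of_one_le_right (abs_nonneg _) hd
  have hle2 : |hh c * (x i 0 * x (i + 1) 1 - x (i + 1) 0 * x i 1)| ≤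
      2 * K * (‖rem Θ (x i) (y i)‖ * ‖x (i + 1)‖) := by
    obtain rfl | rfl : c = 0 ∨ c = 1 := by omega
    · convert bound 1 using 2; ring
    · rw [← abs_neg]
      convert bound 0 using 2; ring
  linarith

/-- The pair at m is an integer matrix of nonzero determinant times the basis pair at n, so each
minor at n is at most the same minor at m. The 6 is 3 from the lower bound for minors times 2 from
the upper bound. -/
theorem mul_norm_le_of_mem_span (h : IsBestSeq Θ x y) {n m : ℕ}
    (hn : x n 0 * x (n + 1) 1 - x (n + 1) 0 * x n 1 ≠ 0)
    (hm : x m 0 * x (m + 1) 1 - x (m + 1) 0 * x m 1 ≠ 0)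
    (h0 : vec (x n) (y n) ∈ span ℚ (Set.range ![vec (x m) (y m), vec (x (m + 1)) (y (m + 1))]))
    (h1 : vec (x (n + 1)) (y (n + 1)) ∈
      span ℚ (Set.range ![vec (x m) (y m), vec (x (m + 1)) (y (m + 1))])) :
    ‖rem Θ (x n) (y n)‖ * ‖x (n + 1)‖ ≤ 6 * (‖rem Θ (x m) (y m)‖ * ‖x (m + 1)‖) := by
  have hspan : span ℚ (Set.range ![vec (x n) (y n), vec (x (n + 1)) (y (n + 1))]) =
      span ℚ (Set.range ![vec (x m) (y m), vec (x (m + 1)) (y (m + 1))]) := by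
    refine Submodule.eq_of_le_of_finrank_eq (span_le.2 ?_) ?_
    · rintro _ ⟨i, rfl⟩
      fin_cases i
      exacts [h0, h1]
    · rw [finrank_span_eq_card (linearIndependent_vec hn),
        finrank_span_eq_card (linearIndependent_vec hm)]
  have comb : ∀ k, vec (x k) (y k) ∈
      span ℚ (Set.range ![vec (x m) (y m), vec (x (m + 1)) (y (m + 1))]) →
      ∃ s t : ℤ, (∀ j, x k j = s * x n j + t * x (n + 1) j) ∧
        ∀ j, y k j = s * y n j + t * y (n + 1) j := by
    intro k hk
    rw [← hspan, Submodule.mem_span_range_iff_exists_fun] at hk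
    obtain ⟨c, hc⟩ := hk
    rw [Fin.sum_univ_two] at hc
    have e0 := congrFun hc 0
    have e1 := congrFun hc 1
    have e2 := congrFun hc 2
    have e3 := congrFun hc 3
    simp [vec] at e0 e1 e2 e3
    refine h.exists_int_comb hn (r := (c 0 : ℝ)) (r' := (c 1 : ℝ)) (fun j => ?_) fun j => ?_
    · obtain rfl | rfl : j = 0 ∨ j = 1 := by omega
      · exact_mod_cast e0.symm
      · exact_mod_cast e1.symm
    · obtain rfl | rfl : j = 0 ∨ j = 1 := by omega
      · exact_mod_cast e2.symm
      · exact_mod_cast e3.symm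
  obtain ⟨s, t, hx, hy⟩ := comb m (subset_span ⟨0, rfl⟩)
  obtain ⟨s', t', hx', hy'⟩ := comb (m + 1) (subset_span ⟨1, rfl⟩)
  have hdet : s * t' - s' * t ≠ 0 := by
    intro hz
    apply hm
    rw [hx, hx, hx', hx']
    linear_combination (x n 0 * x (n + 1) 1 - x (n + 1) 0 * x n 1) * hz
  have hdet1 : (1 : ℝ) ≤ |(s * t' - s' * t : ℝ)| := by exact_mod_cast Int.one_le_abs hdet
  have hr : ∀ j, rem Θ (x m) (y m) j = s * rem Θ (x n) (y n) j
      + t * rem Θ (x (n + 1)) (y (n + 1)) j := fun j => by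
    rw [← rem_add_mul]
    simp only [← hx, ← hy]
  have hr' : ∀ j, rem Θ (x (m + 1)) (y (m + 1)) j = s' * rem Θ (x n) (y n) j
      + t' * rem Θ (x (n + 1)) (y (n + 1)) j := fun j => by
    rw [← rem_add_mul]
    simp only [← hx', ← hy']
  obtain ⟨a, b, hab⟩ := h.exists_le_minor n
  have hle := h.abs_minor_le m a b
  have e : x m a * rem Θ (x (m + 1)) (y (m + 1)) b - x (m + 1) a * rem Θ (x m) (y m) b
      = (s * t' - s' * t) * (x n a * rem Θ (x (n + 1)) (y (n + 1)) b
        - x (n + 1) a * rem Θ (x n) (y n) b) := by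
    rw [hr, hr', hx, hx']
    push_cast
    ring
  rw [e, abs_mul] at hle
  have := le_mul_of_one_le_left (abs_nonneg (x n a * rem Θ (x (n + 1)) (y (n + 1)) b
        - x (n + 1) a * rem Θ (x n) (y n) b)) hdet1
  linarith

end IsBestSeq

end DiophantineExponents

/-! ### Dirichlet's theorem and existence of best approximations -/

namespace DiophantineExponents

variable {Θ : Matrix (Fin 2) (Fin 2) ℝ}

theorem psi_le_zeta {t : ℝ} {x : Fin 2 → ℤ} (hx : x ≠ 0) (ht : ‖x‖ ≤ t) :
    psi Θ t ≤ zeta Θ x :=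
  csInf_le ⟨0, by rintro _ ⟨u, -, rfl⟩; exact norm_nonneg _⟩ ⟨x, ⟨norm_pos_iff.2 hx, ht⟩, rfl⟩

theorem exists_psi_eq {t : ℝ} (ht : 1 ≤ t) : ∃ x : Fin 2 → ℤ, x ≠ 0 ∧ ‖x‖ ≤ t ∧
    psi Θ t = zeta Θ x := by
  have hfin : (zeta Θ '' {x : Fin 2 → ℤ | 0 < ‖x‖ ∧ ‖x‖ ≤ t}).Finite :=
    ((finite_norm_le t).subset fun x hx => hx.2).image _
  have hne : (zeta Θ '' {x : Fin 2 → ℤ | 0 < ‖x‖ ∧ ‖x‖ ≤ t}).Nonempty := by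
    refine ⟨_, fun _ => 1, ⟨?_, ?_⟩, rfl⟩
    · exact norm_pos_iff.2 fun h => by simpa using congrFun h 0
    · refine le_trans ?_ ht
      exact (pi_norm_le_iff_of_nonneg zero_le_one).2 fun i => by simp
  obtain ⟨x, ⟨hx0, hxt⟩, hx⟩ := hne.csInf_mem hfin
  exact ⟨x, norm_pos_iff.1 hx0, hxt, hx.symm⟩

/-- Dirichlet's theorem for two linear forms in two variables. -/
theorem exists_zeta_le (Θ : Matrix (Fin 2) (Fin 2) ℝ) {Q : ℕ} (hQ : 0 < Q) :
    ∃ x : Fin 2 → ℤ, x ≠ 0 ∧ ‖x‖ ≤ Q ∧ zeta Θ x ≤ 1 / Q := by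
  have hQ' : (0 : ℝ) < Q := by exact_mod_cast hQ
  set L : (Fin 2 → Fin (Q + 1)) → Fin 2 → ℝ := fun p j => ∑ i, Θ j i * ((p i : ℕ) : ℝ) with hL
  have hlt : ∀ p j, ⌊Q * Int.fract (L p j)⌋₊ < Q := fun p j => by
    rw [Nat.floor_lt (mul_nonneg hQ'.le (Int.fract_nonneg _))]
    exact mul_lt_of_lt_one_right hQ' (Int.fract_lt_one _)
  -- Pigeonhole: (Q + 1)² integer points, Q² boxes of side 1/Q.
  obtain ⟨p, p', hne, heq⟩ := Fintype.exists_ne_map_eq_of_card_lt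
    (fun (p : Fin 2 → Fin (Q + 1)) (j : Fin 2) => (⟨_, hlt p j⟩ : Fin Q)) (by
      simp only [Fintype.card_fun, Fintype.card_fin]
      exact Nat.pow_lt_pow_left (Nat.lt_succ_self Q) two_ne_zero)
  refine ⟨fun i => (p i : ℤ) - (p' i : ℤ), ?_, ?_, ?_⟩
  · intro h0
    apply hne
    ext i
    have := congrFun h0 i
    simp only [Pi.zero_apply] at this
    omega
  · refine (pi_norm_le_iff_of_nonneg hQ'.le).2 fun i => ?_
    rw [Int.norm_eq_abs, ← Int.cast_abs]
    have : |((p i : ℕ) : ℤ) - ((p' i : ℕ) : ℤ)| ≤ Q := by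
      rw [abs_le]
      have h1 := (p i).isLt
      have h2 := (p' i).isLt
      omega
    exact_mod_cast this
  · refine (zeta_le_norm_rem Θ _ fun j => ⌊L p j⌋ - ⌊L p' j⌋).trans ?_
    refine (pi_norm_le_iff_of_nonneg (by positivity)).2 fun j => ?_
    have e : rem Θ (fun i => (p i : ℤ) - (p' i : ℤ)) (fun j => ⌊L p j⌋ - ⌊L p' j⌋) j
        = Int.fract (L p j) - Int.fract (L p' j) := by
      simp only [rem, hL, Int.fract, Fin.sum_univ_two]
      push_cast
      ring
    rw [Real.norm_eq_abs, e, le_div_iff₀ hQ', ← abs_of_pos hQ', ← abs_mul]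
    have h0 : ⌊Q * Int.fract (L p j)⌋₊ = ⌊Q * Int.fract (L p' j)⌋₊ :=
      congrArg Fin.val (congrFun heq j)
    have h1 := Nat.floor_le (mul_nonneg hQ'.le (Int.fract_nonneg (L p j)))
    have h2 := Nat.floor_le (mul_nonneg hQ'.le (Int.fract_nonneg (L p' j)))
    have h3 := Nat.lt_floor_add_one (Q * Int.fract (L p j))
    have h4 := Nat.lt_floor_add_one (Q * Int.fract (L p' j))
    rw [h0] at h1 h3
    rw [abs_le]
    constructor <;> linarith

theorem psi_le_two_div {t : ℝ} (ht : 1 ≤ t) : psi Θ t ≤ 2 / t := by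
  have hQ : 0 < ⌊t⌋₊ := Nat.floor_pos.2 ht
  obtain ⟨x, hx, hxQ, hz⟩ := exists_zeta_le Θ hQ
  have h1 : psi Θ t ≤ zeta Θ x := psi_le_zeta hx (hxQ.trans (Nat.floor_le (by linarith)))
  have hQ' : (1 : ℝ) ≤ (⌊t⌋₊ : ℝ) := by exact_mod_cast hQ
  refine h1.trans (hz.trans ?_)
  rw [div_le_div_iff₀ (by linarith) (by linarith)]
  linarith [Nat.lt_floor_add_one t]

theorem exists_isBestSeq (hpos : ∀ x : Fin 2 → ℤ, x ≠ 0 → 0 < zeta Θ x) :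
    ∃ x : ℕ → Fin 2 → ℤ, IsBestSeq Θ x fun i => nearest Θ (x i) := by
  let T := {x : Fin 2 → ℤ // x ≠ 0 ∧ ∀ u, u ≠ 0 → ‖u‖ ≤ ‖x‖ → zeta Θ x ≤ zeta Θ u}
  have start : Nonempty T := by
    obtain ⟨x, hx0, hx1, hx⟩ := exists_psi_eq (Θ := Θ) le_rfl
    exact ⟨x, hx0, fun u hu hux => hx ▸ psi_le_zeta hu (hux.trans hx1)⟩
  have step : ∀ p : T, ∃ q : T, ‖p.1‖ < ‖q.1‖ ∧ zeta Θ q.1 < zeta Θ p.1 ∧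
      ∀ u, u ≠ 0 → ‖u‖ < ‖q.1‖ → zeta Θ p.1 ≤ zeta Θ u := by
    rintro ⟨x, hx0, hx⟩
    obtain ⟨n, hn⟩ := exists_nat_one_div_lt (hpos x hx0)
    obtain ⟨w, hw0, -, hw⟩ := exists_zeta_le Θ (Nat.succ_pos n)
    have hwx : zeta Θ w < zeta Θ x := hw.trans_lt (by exact_mod_cast hn)
    have hfin : {u : Fin 2 → ℤ | ‖u‖ ≤ ‖w‖ ∧ u ≠ 0 ∧ zeta Θ u < zeta Θ x}.Finite :=
      (finite_norm_le ‖w‖).subset fun u hu => hu.1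
    -- The next approximation has least norm among the points improving on x; ties are broken by the
    -- remainder, so that q is again best at its own norm.
    obtain ⟨q, ⟨hqw, hq0, hqx⟩, hmin⟩ := hfin.exists_minimalFor
      (fun u => toLex (‖u‖, zeta Θ u)) _ ⟨w, le_rfl, hw0, hwx⟩
    have hmin' : ∀ u, u ≠ 0 → zeta Θ u < zeta Θ x →
        ‖q‖ < ‖u‖ ∨ ‖q‖ = ‖u‖ ∧ zeta Θ q ≤ zeta Θ u := by
      intro u hu0 hux
      by_cases huw : ‖u‖ ≤ ‖w‖
      · rcases le_total (toLex (‖q‖, zeta Θ q)) (toLex (‖u‖, zeta Θ u)) with h | h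
        · exact Prod.Lex.toLex_le_toLex.1 h
        · exact Prod.Lex.toLex_le_toLex.1 (hmin ⟨huw, hu0, hux⟩ h)
      · exact Or.inl (hqw.trans_lt (not_le.1 huw))
    refine ⟨⟨q, hq0, fun u hu0 huq => ?_⟩, ?_, hqx, fun u hu0 huq => ?_⟩
    · by_contra! hc
      rcases hmin' u hu0 (hc.trans hqx) with h | ⟨-, h⟩ <;> linarith
    · by_contra! hc
      exact absurd (hx q hq0 hc) (not_le.2 hqx)
    · by_contra! hc
      rcases hmin' u hu0 hc with h | ⟨h, -⟩ <;> dsimp only at huq <;> linarith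
  choose next hnext using step
  let s : ℕ → T := fun n => Nat.rec start.some (fun _ p => next p) n
  refine ⟨fun i => (s i).1, fun i => (s i).2.1, fun i => (hnext (s i)).1, fun i => ?_,
    fun i u v hu hlt => ?_⟩
  · rw [norm_rem_nearest, norm_rem_nearest]
    exact (hnext (s i)).2.1
  · rw [norm_rem_nearest]
    exact ((hnext (s i)).2.2 u hu hlt).trans (zeta_le_norm_rem Θ u v)

theorem add_one_le_norm_of_lt {x x' : Fin 2 → ℤ} (h : ‖x‖ < ‖x'‖) : ‖x‖ + 1 ≤ ‖x'‖ := by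
  have key : ∀ u : Fin 2 → ℤ, ∃ n : ℤ, ‖u‖ = n := fun u => by
    obtain ⟨i, hi⟩ := exists_le_abs_of_le_norm (v := fun i => (u i : ℝ)) le_rfl
    refine ⟨|u i|, ?_⟩
    rw [norm_intCast] at hi
    rw [Int.cast_abs]
    exact le_antisymm hi (abs_intCast_le_norm u i)
  obtain ⟨n, hn⟩ := key x
  obtain ⟨n', hn'⟩ := key x'
  rw [hn, hn'] at h ⊢
  exact_mod_cast h

theorem IsBestSeq.tendsto_norm {x y : ℕ → Fin 2 → ℤ} (h : IsBestSeq Θ x y) :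
    Filter.Tendsto (fun i => ‖x i‖) Filter.atTop Filter.atTop := by
  refine Filter.tendsto_atTop_mono (fun i => ?_) tendsto_natCast_atTop_atTop
  induction i with
  | zero => simp
  | succ i ih =>
    push_cast
    linarith [add_one_le_norm_of_lt (h.norm_lt i)]

end DiophantineExponents

/-! ### The function `g3` and the logarithmic inequality -/

namespace DiophantineExponents

theorem g3_spec {a : ℝ} (ha : 1 ≤ a) (x : ℝ) :
    (0 < x ∧ a * x ^ 2 + (a - 1) * x - (2 * a ^ 2 - 2 * a + 1) = 0) ↔ x = g3 a := by
  have hc : 0 < 2 * a ^ 2 - 2 * a + 1 := by nlinarith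
  have hac : 0 < 4 * a * (2 * a ^ 2 - 2 * a + 1) := by positivity
  have hsq := Real.sq_sqrt (show 0 ≤ (1 - a) ^ 2 + 4 * a * (2 * a ^ 2 - 2 * a + 1) by positivity)
  have hs0 := Real.sqrt_nonneg ((1 - a) ^ 2 + 4 * a * (2 * a ^ 2 - 2 * a + 1))
  have hs : a - 1 < √((1 - a) ^ 2 + 4 * a * (2 * a ^ 2 - 2 * a + 1)) :=
    Real.lt_sqrt_of_sq_lt (by nlinarith)
  unfold g3
  set s := √((1 - a) ^ 2 + 4 * a * (2 * a ^ 2 - 2 * a + 1))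
  rw [eq_div_iff (by positivity)]
  constructor
  · rintro ⟨hx, h⟩
    have h1 : (x * (2 * a) - (1 - a) - s) * (x * (2 * a) - (1 - a) + s) = 0 := by
      linear_combination 4 * a * h - hsq
    have h2 : 0 < x * (2 * a) - (1 - a) + s := by nlinarith
    linarith [(mul_eq_zero.1 h1).resolve_right h2.ne']
  · intro h
    have h1 : 0 < x := by
      have : 0 < x * (2 * a) := by linarith
      exact pos_of_mul_pos_left this (by linarith)
    refine ⟨h1, ?_⟩
    have h2 : 4 * a * (a * x ^ 2 + (a - 1) * x - (2 * a ^ 2 - 2 * a + 1)) = 0 := by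
      have : s = x * (2 * a) - (1 - a) := by linarith
      rw [this] at hsq
      linear_combination hsq
    exact (mul_eq_zero.1 h2).resolve_left (by positivity)

theorem quadratic_neg_iff {a x : ℝ} (ha : 1 ≤ a) (hx : 0 ≤ x) :
    a * x ^ 2 + (a - 1) * x - (2 * a ^ 2 - 2 * a + 1) < 0 ↔ x < g3 a := by
  obtain ⟨h0, h⟩ := (g3_spec ha _).2 rfl
  have e : a * x ^ 2 + (a - 1) * x - (2 * a ^ 2 - 2 * a + 1)
      = (x - g3 a) * (a * (x + g3 a) + (a - 1)) := by linear_combination h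
  have hp : 0 < a * (x + g3 a) + (a - 1) := by
    have : 0 < a * (x + g3 a) := by positivity
    linarith
  rw [e, ← sub_neg (a := x), mul_neg_iff]
  constructor
  · rintro (h | h)
    · linarith [h.2]
    · exact h.1
  · exact fun h => Or.inr ⟨h, hp⟩

theorem continuousAt_g3 {a : ℝ} (ha : 0 < a) : ContinuousAt g3 a := by
  unfold g3
  refine ContinuousAt.div (by fun_prop) (by fun_prop) (by positivity)

theorem g3_one : g3 1 = 1 := ((g3_spec le_rfl 1).1 (by norm_num)).symm

theorem sub_one_lt_g3 {a : ℝ} (h1 : 1 < a) (h2 : a < ((1 + √5) / 2) ^ 2) : a - 1 < g3 a := by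
  rw [← quadratic_neg_iff h1.le (by linarith)]
  have h5 := Real.sq_sqrt (show (0 : ℝ) ≤ 5 by norm_num)
  have h6 : 1 < √5 := Real.lt_sqrt_of_sq_lt (by norm_num)
  -- At x = a - 1 the quadratic equals a(a² - 3a + 1), and the larger root of a² - 3a + 1 is the
  -- square of the golden ratio.
  have h7 : (a - (3 + √5) / 2) * (a - (3 - √5) / 2) < 0 :=
    mul_neg_of_neg_of_pos (by nlinarith) (by linarith)
  have h8 : a ^ 2 - 3 * a + 1 < 0 := by nlinarith
  nlinarith

/-- The inequality between the logarithms of the norms and the remainders of best approximations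
which bounds the size of an approximation when the ratio of the exponents is small. -/
theorem log_norm_bound {γ b K p a c d zn zν zm zk : ℝ} (hγ : 1 < γ)
    (hp : 0 ≤ p) (hpa : p ≤ a) (hpc : p ≤ c)
    (hdet : 0 ≤ K + zn + zm + c + d) (hplane : zν + a ≤ K + zm + c)
    (un : zn + γ * p ≤ K) (um : zm + γ * c ≤ K) (uk : zk + γ * d ≤ K)
    (wν : 0 ≤ b * p + zν) (wk : 0 ≤ b * c + zk) :
    p * γ ^ 2 ≤ (3 * γ + 1) * K ∨
      p * (γ ^ 2 * (γ - 1) - (b - γ ^ 2 + γ) * (b - 1)) ≤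
        ((3 * γ + 1) * (γ - 1) + 2 * (b - γ ^ 2 + γ)) * K := by
  -- In the application `p`, `a`, `c`, `d` are the logarithms of X_{n+1}, X_{n+2}, X_{m+1}, X_{m+2}.
  -- The determinant bound gives `hA` once d is bounded through ζ_{m+1}; the plane bound gives `hB`;
  -- then c is eliminated.
  have hA : γ ^ 2 * p ≤ (3 * γ + 1) * K + (b - γ ^ 2 + γ) * c := by
    have h1 : γ * (γ * p + γ * c - c) ≤ γ * (3 * K + d) :=
      mul_le_mul_of_nonneg_left (by linarith) (by linarith)
    nlinarith
  have hB : (γ - 1) * c ≤ (b - 1) * p + 2 * K := by linarith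
  rcases le_total (b - γ ^ 2 + γ) 0 with h | h
  · left
    have := mul_nonpos_of_nonpos_of_nonneg h (hp.trans hpc)
    linarith
  · right
    have h1 := mul_le_mul_of_nonneg_left hA (show 0 ≤ γ - 1 by linarith)
    have h2 := mul_le_mul_of_nonneg_left hB h
    linarith

/-! ### Exponents along best approximations, and the conclusion -/

variable {Θ : Matrix (Fin 2) (Fin 2) ℝ}

theorem uniformExponent_le_individualExponent : uniformExponent Θ ≤ individualExponent Θ :=
  sSup_le_sSup (Set.image_mono fun _ hγ =>
    ⟨hγ.1, (Filter.liminf_le_limsup).trans_lt hγ.2⟩)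

theorem one_le_uniformExponent : 1 ≤ uniformExponent Θ := by
  refine le_sSup ⟨1, ⟨one_pos, ?_⟩, ENNReal.ofReal_one⟩
  refine lt_of_le_of_lt (Filter.limsup_le_of_le (a := 2) (by isBoundedDefault) ?_)
    ENNReal.ofNat_lt_top
  filter_upwards [Filter.eventually_ge_atTop 1] with t ht
  have h := psi_le_two_div (Θ := Θ) ht
  rw [le_div_iff₀ (by linarith)] at h
  rw [Real.rpow_one, ← ENNReal.ofReal_ofNat]
  exact ENNReal.ofReal_le_ofReal (by linarith)

namespace IsBestSeq

variable {x y : ℕ → Fin 2 → ℤ}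

theorem rem_le_psi (h : IsBestSeq Θ x y) {i : ℕ} {t : ℝ} (ht : 1 ≤ t) (hlt : t < ‖x (i + 1)‖) :
    ‖rem Θ (x i) (y i)‖ ≤ psi Θ t := by
  obtain ⟨u, hu0, hut, hu⟩ := exists_psi_eq (Θ := Θ) ht
  rw [hu, ← norm_rem_nearest]
  exact h.minimal i u _ hu0 (hut.trans_lt hlt)

theorem eventually_rem_mul_rpow_le (h : IsBestSeq Θ x y) {γ : ℝ}
    (hγ : Filter.limsup (fun t : ℝ => ENNReal.ofReal (t ^ γ * psi Θ t)) Filter.atTop < ⊤) :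
    ∃ C : ℝ, 0 < C ∧ ∀ᶠ i in Filter.atTop, ‖rem Θ (x i) (y i)‖ * ‖x (i + 1)‖ ^ γ ≤ C := by
  obtain ⟨c, hc, hct⟩ := exists_between hγ
  have hev := Filter.eventually_lt_of_limsup_lt hc
  -- ψ is bounded below by ζ_i only strictly before X_{i+1}, so it is evaluated at X_{i+1}/2, at the
  -- cost of a factor 2^γ.
  have ht : Filter.Tendsto (fun i => ‖x (i + 1)‖ / 2) Filter.atTop Filter.atTop :=
    (h.tendsto_norm.comp (Filter.tendsto_add_atTop_nat 1)).atTop_div_const two_pos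
  refine ⟨c.toReal * 2 ^ γ + 1, by positivity, ?_⟩
  filter_upwards [ht.eventually hev, ht.eventually_ge_atTop 1] with i h1 h2
  have hM := h.norm_pos (i + 1)
  have h3 : (‖x (i + 1)‖ / 2) ^ γ * psi Θ (‖x (i + 1)‖ / 2) ≤ c.toReal := by
    rw [← ENNReal.ofReal_le_iff_le_toReal hct.ne]
    exact h1.le
  have h4 := h.rem_le_psi (i := i) h2 (by linarith)
  have h5 := (mul_le_mul_of_nonneg_left h4 (by positivity)).trans h3
  rw [Real.div_rpow hM.le two_pos.le, div_mul_eq_mul_div, div_le_iff₀ (by positivity)] at h5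
  linarith

theorem eventually_one_le_rpow_mul_rem (h : IsBestSeq Θ x y) {b : ℝ}
    (hb : Filter.liminf (fun t : ℝ => ENNReal.ofReal (t ^ b * psi Θ t)) Filter.atTop = ⊤) :
    ∀ᶠ i in Filter.atTop, 1 ≤ ‖x i‖ ^ b * ‖rem Θ (x i) (y i)‖ := by
  have hev := Filter.eventually_lt_of_lt_liminf
    (show 1 < Filter.liminf (fun t : ℝ => ENNReal.ofReal (t ^ b * psi Θ t)) Filter.atTop by
      rw [hb]; exact ENNReal.one_lt_top)
  filter_upwards [h.tendsto_norm.eventually hev] with i hi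
  rw [ENNReal.one_lt_ofReal] at hi
  refine hi.le.trans (mul_le_mul_of_nonneg_left ?_ (Real.rpow_nonneg (norm_nonneg _) b))
  exact (psi_le_zeta (h.ne_zero i) le_rfl).trans (zeta_le_norm_rem Θ _ _)

theorem tendsto_rem_mul_norm (h : IsBestSeq Θ x y) {γ C : ℝ} (hγ : 1 < γ)
    (hC : ∀ᶠ i in Filter.atTop, ‖rem Θ (x i) (y i)‖ * ‖x (i + 1)‖ ^ γ ≤ C) :
    Filter.Tendsto (fun i => ‖rem Θ (x i) (y i)‖ * ‖x (i + 1)‖) Filter.atTop (nhds 0) := by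
  have ht : Filter.Tendsto (fun i => C * ‖x (i + 1)‖ ^ (-(γ - 1))) Filter.atTop (nhds (C * 0)) :=
    (((tendsto_rpow_neg_atTop (by linarith)).comp
      (h.tendsto_norm.comp (Filter.tendsto_add_atTop_nat 1)))).const_mul C
  rw [mul_zero] at ht
  refine squeeze_zero' (Filter.Eventually.of_forall fun i => by positivity) ?_ ht
  filter_upwards [hC] with i hi
  have hM := h.norm_pos (i + 1)
  have e : ‖x (i + 1)‖ = ‖x (i + 1)‖ ^ γ * ‖x (i + 1)‖ ^ (-(γ - 1)) := by
    rw [← Real.rpow_add hM]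
    norm_num
  calc ‖rem Θ (x i) (y i)‖ * ‖x (i + 1)‖
      = ‖rem Θ (x i) (y i)‖ * ‖x (i + 1)‖ ^ γ * ‖x (i + 1)‖ ^ (-(γ - 1)) := by
        rw [mul_assoc, ← e]
    _ ≤ C * ‖x (i + 1)‖ ^ (-(γ - 1)) := mul_le_mul_of_nonneg_right hi (by positivity)

end IsBestSeq

theorem mul_g3_le {γ b : ℝ}
    (hΘ : LinearIndependent ℤ
      (fun o : Option (Fin 2 × Fin 2) => o.elim (1 : ℝ) (fun p => Θ p.1 p.2)))
    (hγ1 : 1 < γ) (hγb : γ ≤ b)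
    (hγ : Filter.limsup (fun t : ℝ => ENNReal.ofReal (t ^ γ * psi Θ t)) Filter.atTop < ⊤)
    (hb : Filter.liminf (fun t : ℝ => ENNReal.ofReal (t ^ b * psi Θ t)) Filter.atTop = ⊤) :
    γ * g3 γ ≤ b := by
  by_contra! hlt
  have hγ0 : 0 < γ := by linarith
  have hneg : (b - γ ^ 2 + γ) * (b - 1) < γ ^ 2 * (γ - 1) := by
    have h1 : b / γ < g3 γ := by rwa [div_lt_iff₀' hγ0]
    rw [← quadratic_neg_iff hγ1.le (div_nonneg (by linarith) hγ0.le)] at h1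
    have h2 : γ * (γ * (b / γ) ^ 2 + (γ - 1) * (b / γ) - (2 * γ ^ 2 - 2 * γ + 1)) < 0 :=
      mul_neg_of_pos_of_neg hγ0 h1
    have h3 : γ * (γ * (b / γ) ^ 2 + (γ - 1) * (b / γ) - (2 * γ ^ 2 - 2 * γ + 1))
        = b ^ 2 + (γ - 1) * b - γ * (2 * γ ^ 2 - 2 * γ + 1) := by
      field_simp
    rw [h3] at h2
    -- The difference of the sides of `hneg` equals the quadratic in b of `h2` minus γ²(b - γ).
    nlinarith [mul_nonneg (sq_nonneg γ) (sub_nonneg.2 hγb)]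
  obtain ⟨x, h⟩ := exists_isBestSeq (Θ := Θ) fun x hx => zeta_pos hΘ hx
  set y : ℕ → Fin 2 → ℤ := fun i => nearest Θ (x i)
  obtain ⟨C, hC0, hC⟩ := h.eventually_rem_mul_rpow_le hγ
  have hlim := h.tendsto_rem_mul_norm hγ1 hC
  have hsmall : ∀ᶠ i in Filter.atTop, 2 * (‖rem Θ (x i) (y i)‖ * ‖x (i + 1)‖) < 1 :=
    (hlim.const_mul 2).eventually_lt_const (by norm_num)
  -- One K absorbs the constants C, 24 and 6.
  set K : ℝ := max (Real.log C) (Real.log 24) with hK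
  have hK24 : Real.log 24 ≤ K := le_max_right _ _
  have hKC : Real.log C ≤ K := le_max_left _ _
  have hK6 : Real.log 6 ≤ K := (Real.log_le_log (by norm_num) (by norm_num)).trans hK24
  have hlog : Filter.Tendsto (fun i => Real.log ‖x i‖) Filter.atTop Filter.atTop :=
    Real.tendsto_log_atTop.comp h.tendsto_norm
  have hbig : ∀ᶠ i in Filter.atTop, (3 * γ + 1) * K < Real.log ‖x i‖ * γ ^ 2 :=
    (hlog.atTop_mul_const (by positivity)).eventually_gt_atTop _
  have hbig' : ∀ᶠ i in Filter.atTop, ((3 * γ + 1) * (γ - 1) + 2 * (b - γ ^ 2 + γ)) * K <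
      Real.log ‖x i‖ * (γ ^ 2 * (γ - 1) - (b - γ ^ 2 + γ) * (b - 1)) :=
    (hlog.atTop_mul_const (sub_pos.2 hneg)).eventually_gt_atTop _
  obtain ⟨N, hN⟩ := Filter.eventually_atTop.1
    (hC.and (hsmall.and ((h.eventually_one_le_rpow_mul_rem hb).and (hbig.and hbig'))))
  have hdet : ∀ i, N ≤ i → x i 0 * x (i + 1) 1 - x (i + 1) 0 * x i 1 ≠ 0 :=
    fun i hi => h.det_ne_zero (hN i hi).2.1
  obtain ⟨n, m, hNn, hnm, hspan, hind⟩ := exists_linearIndependent_four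
    (V := Fin 4 → ℚ) (by simp) (z := fun i => vec (x i) (y i)) (N := N)
    (fun i hi => linearIndependent_vec (hdet i hi))
    (fun W hW => h.exists_notMem_submodule hΘ hlim W hW N)
  have mono : ∀ {i j : ℕ}, i ≤ j → ‖x i‖ ≤ ‖x j‖ := fun hij => h.strictMono_norm.monotone hij
  have anti : ∀ {i j : ℕ}, i ≤ j → ‖rem Θ (x j) (y j)‖ ≤ ‖rem Θ (x i) (y i)‖ :=
    fun hij => h.strictAnti_rem.antitone hij
  have hvol := one_le_of_linearIndependent Θ hind (mono (by omega)) (mono (by omega))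
    (mono (by omega)) (anti (by omega)) (anti (by omega)) (anti (by omega))
  have hplane := h.mul_norm_le_of_mem_span (hdet (n + 1) (by omega)) (hdet m (by omega))
    (hspan (n + 1) le_rfl (by omega)) (hspan (n + 2) (by omega) (by omega))
  have zpos := fun i => (h.rem_pos i).ne'
  have xpos := fun i => (h.norm_pos i).ne'
  have lvol := Real.log_le_log one_pos hvol
  rw [Real.log_one, Real.log_mul (by norm_num) (by simp [zpos, xpos]),
    Real.log_mul (by simp [zpos]) (by simp [xpos]), Real.log_mul (zpos _) (zpos _),
    Real.log_mul (xpos _) (xpos _)] at lvol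
  have lplane := Real.log_le_log (mul_pos (h.rem_pos _) (h.norm_pos _)) hplane
  rw [Real.log_mul (zpos _) (xpos _), Real.log_mul (by norm_num) (by simp [zpos, xpos]),
    Real.log_mul (zpos _) (xpos _)] at lplane
  have upper : ∀ i, N ≤ i →
      Real.log ‖rem Θ (x i) (y i)‖ + γ * Real.log ‖x (i + 1)‖ ≤ K := fun i hi => by
    have := Real.log_le_log (mul_pos (h.rem_pos i) (Real.rpow_pos_of_pos (h.norm_pos (i + 1)) γ))
      (hN i hi).1
    rw [Real.log_mul (zpos _) (Real.rpow_pos_of_pos (h.norm_pos (i + 1)) γ).ne',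
      Real.log_rpow (h.norm_pos _)] at this
    exact this.trans hKC
  have lower : ∀ i, N ≤ i →
      0 ≤ b * Real.log ‖x i‖ + Real.log ‖rem Θ (x i) (y i)‖ := fun i hi => by
    have := Real.log_le_log one_pos (hN i hi).2.2.1
    rwa [Real.log_one, Real.log_mul (Real.rpow_pos_of_pos (h.norm_pos i) b).ne' (zpos _),
      Real.log_rpow (h.norm_pos _)] at this
  have hmonolog : ∀ {i j : ℕ}, i ≤ j → Real.log ‖x i‖ ≤ Real.log ‖x j‖ :=
    fun hij => Real.log_le_log (h.norm_pos _) (mono hij)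
  rcases log_norm_bound (K := K) hγ1
    (Real.log_nonneg (one_le_norm_of_ne_zero (h.ne_zero (n + 1))))
    (hmonolog (show n + 1 ≤ n + 1 + 1 by omega)) (hmonolog (show n + 1 ≤ m + 1 by omega))
    (by linarith) (by linarith) (upper n hNn) (upper m (by omega)) (upper (m + 1) (by omega))
    (lower (n + 1) (by omega)) (lower (m + 1) (by omega)) with hc | hc
  · exact absurd (hN (n + 1) (by omega)).2.2.2.1 (not_lt.2 hc)
  · exact absurd (hN (n + 1) (by omega)).2.2.2.2 (not_lt.2 hc)

theorem ofReal_mul_g3_le_individualExponent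
    (hΘ : LinearIndependent ℤ
      (fun o : Option (Fin 2 × Fin 2) => o.elim (1 : ℝ) (fun p => Θ p.1 p.2)))
    (htop : uniformExponent Θ ≠ ⊤) :
    ENNReal.ofReal ((uniformExponent Θ).toReal * g3 (uniformExponent Θ).toReal) ≤
      individualExponent Θ := by
  set a := (uniformExponent Θ).toReal with ha
  have hau : ENNReal.ofReal a = uniformExponent Θ := ENNReal.ofReal_toReal htop
  have ha1 : 1 ≤ a := by
    rw [ha, ← ENNReal.toReal_one]
    exact ENNReal.toReal_mono htop one_le_uniformExponent
  by_contra! hlt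
  obtain ⟨b, hb0, hb1, hb2⟩ := ENNReal.lt_iff_exists_real_btwn.1 hlt
  have hba : b < a * g3 a := (ENNReal.ofReal_lt_ofReal_iff_of_nonneg hb0).1 hb2
  have hab : a < b := by
    rw [← ENNReal.ofReal_lt_ofReal_iff_of_nonneg (by linarith), hau]
    exact uniformExponent_le_individualExponent.trans_lt hb1
  -- At α = 1 no γ > 1 is available, but g₃(1) = 1 and β ≥ α suffices.
  rcases ha1.eq_or_lt with h1 | h1
  · rw [← h1, g3_one] at hba
    linarith
  have hcont : ContinuousAt (fun γ : ℝ => γ * g3 γ) a :=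
    continuousAt_id.mul (continuousAt_g3 (by linarith))
  -- The supremum α need not be admissible itself; continuity preserves b < γ g₃(γ) for admissible γ
  -- just below it.
  obtain ⟨ε, hε, hball⟩ := Metric.eventually_nhds_iff.1
    ((hcont.eventually_const_lt hba).and (lt_mem_nhds h1))
  have hlt' : ENNReal.ofReal (a - ε) < uniformExponent Θ := by
    rw [← hau]
    exact (ENNReal.ofReal_lt_ofReal_iff (by linarith)).2 (by linarith)
  obtain ⟨_, ⟨γ, hγ, rfl⟩, hγlt⟩ := lt_sSup_iff.1 hlt'
  have hγa : γ ≤ a := by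
    rw [← ENNReal.ofReal_le_ofReal_iff (by linarith), hau]
    exact le_sSup ⟨γ, hγ, rfl⟩
  have hγε : a - ε < γ := (ENNReal.ofReal_lt_ofReal_iff hγ.1).1 hγlt
  obtain ⟨hg, hγ1⟩ := hball (show dist γ a < ε by
    rw [Real.dist_eq, abs_lt]; constructor <;> linarith)
  refine absurd (mul_g3_le hΘ hγ1 (hγa.trans hab.le) hγ.2 ?_) (not_le.2 hg)
  by_contra hne
  have hle : ENNReal.ofReal b ≤ individualExponent Θ :=
    le_sSup ⟨b, ⟨by linarith, lt_top_iff_ne_top.2 hne⟩, rfl⟩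
  exact absurd hle (not_le.2 hb1)

end DiophantineExponents

theorem theorem4 :
    -- for `1 ≤ a`, `g3 a` is the unique positive root of `a x² + (a - 1) x - (2 a² - 2 a + 1) = 0`
    (∀ a : ℝ, 1 ≤ a → ∀ x : ℝ,
      (0 < x ∧ a * x ^ 2 + (a - 1) * x - (2 * a ^ 2 - 2 * a + 1) = 0) ↔
        x = DiophantineExponents.g3 a) ∧
    -- the bound
    (∀ Θ : Matrix (Fin 2) (Fin 2) ℝ,
      LinearIndependent ℤ
        (fun o : Option (Fin 2 × Fin 2) => o.elim (1 : ℝ) (fun p => Θ p.1 p.2)) →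
      (∀ t : ℝ, 1 ≤ t → 0 < DiophantineExponents.psi Θ t) ∧
      1 ≤ DiophantineExponents.uniformExponent Θ ∧
      (DiophantineExponents.uniformExponent Θ ≠ ⊤ →
        ENNReal.ofReal ((DiophantineExponents.uniformExponent Θ).toReal *
            DiophantineExponents.g3 (DiophantineExponents.uniformExponent Θ).toReal) ≤
          DiophantineExponents.individualExponent Θ) ∧
      (DiophantineExponents.uniformExponent Θ = ⊤ →
        DiophantineExponents.individualExponent Θ = ⊤)) ∧
    -- the comparison with the bound `a (a - 1)`
    (∀ a : ℝ, 1 < a → a < ((1 + √5) / 2) ^ 2 → a * (a - 1) < a * DiophantineExponents.g3 a) := by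
  refine ⟨fun a ha x => DiophantineExponents.g3_spec ha x, fun Θ hΘ => ⟨fun t ht => ?_,
      DiophantineExponents.one_le_uniformExponent,
      DiophantineExponents.ofReal_mul_g3_le_individualExponent hΘ, fun htop => ?_⟩,
    fun a h1 h2 => mul_lt_mul_of_pos_left (DiophantineExponents.sub_one_lt_g3 h1 h2)
      (one_pos.trans h1)⟩
  · obtain ⟨x, hx0, -, hx⟩ := DiophantineExponents.exists_psi_eq (Θ := Θ) ht
    rw [hx]
    exact DiophantineExponents.zeta_pos hΘ hx0
  · rw [← top_le_iff, ← htop]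
    exact DiophantineExponents.uniformExponent_le_individualExponent
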